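/- Let $D$ be an oriented link diagram. A state $s$ labels every crossing of $D$ with $A$ or $B$; let $a(s)$ and $b(s)$ be the numbers of $A$- and $B$-labels. Smoothing every crossing according to its label gives a collection $sD$ of $|s|$ disjoint circles, together with a chord at the site of each crossing. An enhanced state is a state $s$ together with a sign $\pm1$ on each circle of $sD$; let $\tau(s)$ be the sum of these signs. With $w$ the writhe of $D$, put $$i(s)=\frac{w-(a(s)-b(s))}{2},\qquad j(s)=w+i(s)+\tau(s).$$ Let $s_A$ be the state with all labels $A$, and let $$S_{\min}=\{\,s \text{ an enhanced state of } D : |s|=|s_A|+b(s),\ \tau(s)=-|s|\,\}.$$ The Lando graph $G_D$ has one vertex for each crossing whose chord in $s_AD$ has both ends on the same circle of $s_AD$; two distinct vertices are adjacent if the ends of the corresponding chords alternate on the same circle. For an enhanced state $s$, let $V_s$ be the set of those vertices of $G_D$ whose crossings are labelled $B$ by $s$. Then $S_{\min}$ is exactly the set of enhanced states at which $j$ attains its minimum $j_{\min}$ over all enhanced states of $D$; the map $s\mapsto V_s$ is a bijection from $S_{\min}$ onto the set of independent vertex sets of $G_D$ (including the empty set); and $|V_s|=b(s)$ for every $s\in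 S_{\min}$. -/

import Mathlib

/-- The pieces obtained from a set `H` by gluing `h` to `f h` for all `f ∈ F` and `h : H`: the
quotient of `H` by the equivalence relation generated by `h ∼ f h`.  If `F` consists of
permutations, these are the orbits of the group generated by `F`. -/
abbrev Pieces {H : Type*} (F : Set (H → H)) : Type _ :=
  Quotient (Relation.EqvGen.setoid fun a b : H => ∃ f ∈ F, f a = b)

/-- Two elements of `H` lie in the same piece. -/
def SamePiece {H : Type*} (F : Set (H → H)) (a b : H) : Prop :=
  Relation.EqvGen (fun a b : H => ∃ f ∈ F, f a = b) a b

/-- The four half-edges at every crossing.  At a crossing `x` they are numbered counterclockwise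
`(x, 0), (x, 1), (x, 2), (x, 3)`, where `(x, 0)` is the incoming and `(x, 2)` the outgoing half of
the lower strand; `(x, 1)` and `(x, 3)` are the two halves of the upper strand. -/
abbrev HalfEdge (X : Type*) : Type _ := X × Fin 4

/-- The next half-edge, counterclockwise, at the same crossing. -/
def rot {X : Type*} (h : HalfEdge X) : HalfEdge X := (h.1, h.2 + 1)

/-- Whether a half-edge is directed away from its crossing, for crossing signs `ε`.
The upper strand runs from `(x, 3)` to `(x, 1)` at a positive crossing (so that a counterclockwise
quarter turn takes the upper direction to the lower direction), and from `(x, 1)` to `(x, 3)` at a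
negative one. -/
def IsOutgoing {X : Type*} (ε : X → ℤˣ) (h : HalfEdge X) : Prop :=
  h.2 = 2 ∨ (h.2 = 1 ∧ ε h.1 = 1) ∨ (h.2 = 3 ∧ ε h.1 = -1)

/-- An oriented link diagram with finite set of crossings `X`, presented as a plane 4-valent
graph (a combinatorial map of genus zero, also called a planar diagram code) with crossing
information, together with a number of components that meet no crossing. -/
structure OrientedLinkDiagram (X : Type*) [Fintype X] where
  /-- `opp h` is the other half of the edge that contains the half-edge `h`. -/
  opp : HalfEdge X → HalfEdge X
  opp_opp : ∀ h, opp (opp h) = h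
  /-- The signs of the crossings. -/
  sign : X → ℤˣ
  /-- Every edge runs from an outgoing half-edge to an incoming one; in particular the two halves
  of an edge are different. -/
  outgoing_opp : ∀ h, IsOutgoing sign (opp h) ↔ ¬ IsOutgoing sign h
  /-- The underlying graph is plane: Euler's formula `V - E + F = 2 C`, where `V`, `E`, `F` and `C`
  are the numbers of crossings, edges, faces (orbits of `rot ∘ opp`) and connected components of
  the graph. -/
  planar : Fintype.card X + Nat.card (Pieces {fun h => rot (opp h)})
    = Nat.card (Pieces {opp}) + 2 * Nat.card (Pieces {opp, rot})
  /-- The number of crossingless components of the diagram. -/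
  loops : ℕ

/-- The two possible labels of a crossing in a state. -/
inductive CrossingLabel : Type
  | A
  | B

/-- The way in which a smoothing joins the four half-edges of a crossing in pairs.
The `A`-regions are those swept out by the upper strand when it is turned counterclockwise: they
lie between half-edges `1, 2` and between half-edges `3, 0`.  The `A`-smoothing merges the
`A`-regions, hence joins `0` to `1` and `2` to `3`; the `B`-smoothing joins `0` to `3` and
`1` to `2`. -/
def CrossingLabel.partner : CrossingLabel → Fin 4 → Fin 4
  | .A => ![1, 0, 3, 2]
  | .B => ![3, 2, 1, 0]

namespace OrientedLinkDiagram

variable {X : Type*} [Fintype X] (D : OrientedLinkDiagram X)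

/-- The half-edge that is joined to `h` by the smoothing arcs of the state `s`. -/
def smooth (s : X → CrossingLabel) (h : HalfEdge X) : HalfEdge X :=
  (h.1, (s h.1).partner h.2)

/-- The circles of `sD`: the curves made of edges and smoothing arcs, and the crossingless
components of `D`. -/
abbrev Circle (s : X → CrossingLabel) : Type _ :=
  Pieces {D.opp, smooth s} ⊕ Fin D.loops

noncomputable instance (s : X → CrossingLabel) : Fintype (D.Circle s) := Fintype.ofFinite _

/-- The number `|s|` of circles of `sD`. -/
noncomputable def numCircles (s : X → CrossingLabel) : ℕ := Fintype.card (D.Circle s)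

open Classical in
/-- The number `a(s)` of `A`-labels. -/
noncomputable def numA (s : X → CrossingLabel) : ℕ :=
  (Finset.univ.filter fun x => s x = CrossingLabel.A).card

open Classical in
/-- The number `b(s)` of `B`-labels. -/
noncomputable def numB (s : X → CrossingLabel) : ℕ :=
  (Finset.univ.filter fun x => s x = CrossingLabel.B).card

/-- The state `s_A` that assigns the label `A` to all crossings. -/
def stateA : X → CrossingLabel := fun _ => CrossingLabel.A

/-- An enhanced state: a state together with a sign for each circle of `sD`. -/
structure EnhancedState where
  label : X → CrossingLabel
  sign : D.Circle label → ℤˣ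

variable {D} in
/-- `τ(s)`, the sum of the signs of the circles. -/
noncomputable def EnhancedState.tau (s : D.EnhancedState) : ℤ := ∑ c, (s.sign c : ℤ)

/-- The writhe `w = p - n`, the sum of the signs of the crossings. -/
def writhe : ℤ := ∑ x, (D.sign x : ℤ)

variable {D} in
/-- `i(s) = (w - σ(s)) / 2` with `σ(s) = a(s) - b(s)`; the division is exact. -/
noncomputable def EnhancedState.iDeg (s : D.EnhancedState) : ℤ :=
  (D.writhe - ((numA s.label : ℤ) - numB s.label)) / 2

variable {D} in
/-- `j(s) = w + i(s) + τ(s)`. -/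
noncomputable def EnhancedState.jDeg (s : D.EnhancedState) : ℤ :=
  D.writhe + s.iDeg + s.tau

/-- `S_min`: the enhanced states with `|s| = |s_A| + b(s)` and `τ(s) = -|s|`. -/
def Smin : Set D.EnhancedState :=
  {s | D.numCircles s.label = D.numCircles stateA + numB s.label ∧
    s.tau = -(D.numCircles s.label : ℤ)}

/-- The chord of `s_A D` at the crossing `x` is admissible: its two ends lie on the same circle.
Its ends lie on the smoothing arc through `(x, 0)` and on the one through `(x, 2)`. -/
def Admissible (x : X) : Prop := SamePiece {D.opp, smooth stateA} (x, 0) (x, 2)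

open Classical in
/-- The arcs of `s_A D`, cut open at the two ends of the chord at `x`. -/
noncomputable def cutSmooth (x : X) (h : HalfEdge X) : HalfEdge X :=
  if h.1 = x then h else smooth stateA h

/-- The ends of the chord at `y` lie on different pieces of `s_A D` cut at the two ends of
the chord at `x`. -/
def Separates (x y : X) : Prop := ¬ SamePiece {D.opp, cutSmooth x} (y, 0) (y, 2)

/-- The Lando graph `G_D`: the vertices are the admissible `A`-chords of `s_A D`, and two distinct
ones are adjacent if their ends alternate on one circle, that is, if each chord separates the two
ends of the other on that circle.  (Chords with ends on different circles do not separate each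
other's ends.) -/
def landoGraph : SimpleGraph {x : X // D.Admissible x} where
  Adj x y := x ≠ y ∧ D.Separates x y ∧ D.Separates y x
  symm := ⟨fun _ _ h => ⟨h.1.symm, h.2.2, h.2.1⟩⟩
  loopless := ⟨fun _ h => h.1 rfl⟩

variable {D} in
/-- `V_s`: the vertices of the Lando graph whose crossings are labelled `B` by `s`. -/
def EnhancedState.vertexSet (s : D.EnhancedState) : Set {x : X // D.Admissible x} :=
  {x | s.label x = CrossingLabel.B}

end OrientedLinkDiagram

/-! Relabelling one crossing from `A` to `B` adds at most one circle, so |s| ≤ |s_A| + b(s). Up to a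
constant depending only on `D`, j(s) is b(s) + τ(s), and b(s) + τ(s) ≥ b(s) - |s| ≥ -|s_A|. The
all-minus state on s_A attains this bound, and equality in both steps is the definition of `Smin`.

In `Smin` all signs are -1, so a state there amounts to the set T of its `B`-crossings, and T is
subject to |s_T| = |s_A| + |T|. By `numCircles_labelOn_eq_iff` this holds exactly when the chords of
T are admissible and pairwise non-separating. If it holds for T it holds for every subset, and
singletons and pairs give the two conditions. Conversely, each chord of T cuts its circle into two
arcs, and the indicator of one arc jumps only at that chord. These indicators and the functions
constant on the circles of s_A D span a space over `ZMod 2` of dimension |s_A| + |T|, all of it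
constant on the circles of s_T D.

Planarity enters through `exists_checkerboard`: the colouring fixes how an arc returns to a crossing
(`exists_arc`), so that relabelling an admissible chord really splits its circle. -/

/-! ### Pieces of a gluing and comparison of their numbers. -/

namespace SamePiece

variable {H : Type*} {F : Set (H → H)}

theorem apply_eq {β : Type*} {φ : H → β} (hφ : ∀ f ∈ F, ∀ a, φ (f a) = φ a) {a b : H}
    (h : SamePiece F a b) : φ a = φ b := by
  induction h with
  | rel a b h => obtain ⟨f, hf, rfl⟩ := h; exact (hφ f hf a).symm
  | refl => rfl
  | symm _ _ _ ih => exact ih.symm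
  | trans _ _ _ _ _ ih₁ ih₂ => exact ih₁.trans ih₂

theorem refl (a : H) : SamePiece F a a := Relation.EqvGen.refl a

theorem symm {a b : H} (h : SamePiece F a b) : SamePiece F b a := Relation.EqvGen.symm _ _ h

theorem trans {a b c : H} (h : SamePiece F a b) (h' : SamePiece F b c) : SamePiece F a c :=
  Relation.EqvGen.trans _ _ _ h h'

theorem of_mem {f : H → H} (hf : f ∈ F) (a : H) : SamePiece F a (f a) :=
  Relation.EqvGen.rel _ _ ⟨f, hf, rfl⟩

end SamePiece

namespace Pieces

variable {H : Type*} {F G : Set (H → H)}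

/-- The piece that contains an element. -/
def mk (F : Set (H → H)) (a : H) : Pieces F := Quotient.mk _ a

theorem mk_eq_mk {a b : H} : mk F a = mk F b ↔ SamePiece F a b := Quotient.eq

theorem mk_surjective : Function.Surjective (mk F) := Quotient.mk_surjective

theorem mk_apply {f : H → H} (hf : f ∈ F) (a : H) : mk F (f a) = mk F a :=
  mk_eq_mk.2 (SamePiece.of_mem hf a).symm

/-- A function that is invariant under `F` descends to the pieces. -/
theorem exists_comp_mk {β : Type*} {φ : H → β} (hφ : ∀ f ∈ F, ∀ a, φ (f a) = φ a) :
    ∃ ψ : Pieces F → β, ∀ a, ψ (mk F a) = φ a :=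
  ⟨Quotient.lift φ fun _ _ h => SamePiece.apply_eq hφ h, fun _ => rfl⟩

theorem exists_map (hFG : F ⊆ G) : ∃ m : Pieces F → Pieces G, ∀ a, m (mk F a) = mk G a :=
  exists_comp_mk fun _ hf a => mk_apply (hFG hf) a

theorem card_le_of_subset [Finite H] (hFG : F ⊆ G) : Nat.card (Pieces G) ≤ Nat.card (Pieces F) := by
  obtain ⟨m, hm⟩ := exists_map hFG
  refine Nat.card_le_card_of_surjective m fun c => ?_
  obtain ⟨a, rfl⟩ := mk_surjective c
  exact ⟨mk F a, hm a⟩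

/-- The natural surjection from the pieces of `F` to those of `G` is injective once the finite
cardinalities agree. -/
theorem samePiece_of_card_le [Finite H] (hFG : F ⊆ G)
    (h : Nat.card (Pieces F) ≤ Nat.card (Pieces G)) {a b : H} (hab : SamePiece G a b) :
    SamePiece F a b := by
  obtain ⟨m, hm⟩ := exists_map hFG
  have hs : Function.Surjective m := fun c => by
    obtain ⟨a, rfl⟩ := mk_surjective c
    exact ⟨mk F a, hm a⟩
  have hb : Function.Bijective m := (Nat.bijective_iff_surjective_and_card m).2
    ⟨hs, h.antisymm (card_le_of_subset hFG)⟩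
  exact mk_eq_mk.1 (hb.1 (by rw [hm, hm]; exact mk_eq_mk.2 hab))

/-- If gluing `a` to `b` makes the gluings in `G` superfluous, then `G` merges at most two pieces
of `F`. -/
theorem card_le_add_one [Finite H] (a b : H)
    (hG : ∀ φ : H → Pieces F, (∀ f ∈ F, ∀ c, φ (f c) = φ c) → φ a = φ b →
      ∀ g ∈ G, ∀ c, φ (g c) = φ c) :
    Nat.card (Pieces F) ≤ Nat.card (Pieces G) + 1 := by
  classical
  -- `r` merges the piece of `a` into that of `b`. It descends to the pieces of `G`, so the pieces
  -- other than that of `a` inject into `Pieces G`; `none` takes care of the piece of `a`.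
  let r : Pieces F → Pieces F := fun c => if c = mk F a then mk F b else c
  obtain ⟨ψ, hψ⟩ := exists_comp_mk (F := G) (φ := fun c => r (mk F c))
    (hG (fun c => r (mk F c)) (fun f hf c => congrArg r (mk_apply hf c)) (by simp [r]))
  rw [← Finite.card_option]
  have hinj : Function.Injective
      (fun c : Pieces F => if c = mk F a then none else some (mk G (Quotient.out c))) := by
    intro c d hcd
    by_cases hc : c = mk F a <;> by_cases hd : d = mk F a <;> simp only [hc, hd, if_true, if_false,
      reduceCtorEq, Option.some.injEq] at hcd ⊢
    have h := congrArg ψ hcd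
    have ho : ∀ e : Pieces F, mk F (Quotient.out e) = e := fun e => Quotient.out_eq e
    simpa only [hψ, ho, r, hc, hd, if_false] using h
  exact Nat.card_le_card_of_injective _ hinj

end Pieces

/-! ### Alternating paths and a dimension bound. -/

/-- A path of alternating steps of two involutions that starts at a fixed point of the second one
ends at a second fixed point. -/
theorem exists_other_end {H : Type*} [Finite H] {α β : H → H} (hα : ∀ h, α (α h) = h)
    (hβ : ∀ h, β (β h) = h) {a : H} (ha : β a = a) {c : H → ZMod 2}
    (hcα : ∀ h, c (α h) = c h + 1) (hcβ : ∀ h, β h ≠ h → c (β h) = c h + 1) :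
    ∃ (K : Set H) (b : H), a ∈ K ∧ b ∈ K ∧ β b = b ∧ c b = c a + 1 ∧
      (∀ h ∈ K, α h ∈ K) ∧ (∀ h ∈ K, β h ∈ K) ∧ (∀ h ∈ K, β h = h → h = a ∨ h = b) ∧
      ∀ h ∈ K, SamePiece {α, β} a h := by
  let p : ℕ → H := fun k => (fun h => β (α h))^[k] a
  have hp : ∀ k, p (k + 1) = β (α (p k)) := fun k => Function.iterate_succ_apply' _ _ _
  have hinj : Function.Injective (fun h => β (α h)) := fun u v huv => by
    have := congrArg (fun h => α (β h)) huv
    simpa [hα, hβ] using this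
  -- The injective map `β ∘ α` on a finite type returns to `a`. Just before the return, `β` sends `α
  -- (p k)` to `a`; since `β` is an involution fixing `a`, this means `α (p k) = a`.
  have hex : ∃ k, β (α (p k)) = α (p k) := by
    obtain ⟨m, hm, hper⟩ := (hinj.mem_periodicPts a)
    obtain ⟨k, rfl⟩ : ∃ k, m = k + 1 := ⟨m - 1, by omega⟩
    have h1 : β (α (p k)) = a := by rw [← hp]; exact hper
    refine ⟨k, ?_⟩
    have h2 := congrArg β h1
    rw [hβ, ha] at h2
    rw [h1, h2]
  classical
  let k := Nat.find hex
  have hk : β (α (p k)) = α (p k) := Nat.find_spec hex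
  have hlt : ∀ i < k, β (α (p i)) ≠ α (p i) := fun i hi => Nat.find_min hex hi
  have hc : ∀ i ≤ k, c (p i) = c a := by
    intro i
    induction i with
    | zero => intro _; rfl
    | succ i ih =>
      intro hi
      rw [hp, hcβ _ (hlt i hi), hcα, ih (by omega), add_assoc]
      simp [show (1 + 1 : ZMod 2) = 0 from rfl]
  have hs : ∀ i, SamePiece {α, β} a (p i) := by
    intro i
    induction i with
    | zero => exact .refl _
    | succ i ih =>
      rw [hp]
      exact (ih.trans (.of_mem (f := α) (by simp) _)).trans (.of_mem (f := β) (by simp) _)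
  refine ⟨{h | ∃ i ≤ k, h = p i ∨ h = α (p i)}, α (p k), ⟨0, by omega, .inl rfl⟩,
    ⟨k, le_rfl, .inr rfl⟩, hk, by rw [hcα, hc k le_rfl], ?_, ?_, ?_, ?_⟩
  · rintro h ⟨i, hi, rfl | rfl⟩
    · exact ⟨i, hi, .inr rfl⟩
    · exact ⟨i, hi, .inl (hα _)⟩
  · rintro h ⟨i, hi, rfl | rfl⟩
    · cases i with
      | zero => exact ⟨0, hi, .inl ha⟩
      | succ i => exact ⟨i, by omega, .inr (by rw [hp, hβ])⟩
    · rcases hi.lt_or_eq with hi' | rfl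
      · exact ⟨i + 1, hi', .inl (hp i).symm⟩
      · exact ⟨k, le_rfl, .inr hk⟩
  · rintro h ⟨i, hi, rfl | rfl⟩ hfix
    · cases i with
      | zero => exact .inl rfl
      | succ i =>
        rw [hp, hβ] at hfix
        exact absurd hfix.symm (hlt i hi)
    · rcases hi.lt_or_eq with hi' | rfl
      · exact absurd hfix (hlt i hi')
      · exact .inr rfl
  · rintro h ⟨i, -, rfl | rfl⟩
    · exact hs i
    · exact (hs i).trans (.of_mem (by simp) _)

/-- The image of functions on a smaller type has at most the dimension of that type. -/
theorem finrank_le_card_of_forall_exists_comp {Y Z : Type*} [Finite Y] [Finite Z] (p : Y → Z)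
    {W : Submodule (ZMod 2) (Y → ZMod 2)} (hW : ∀ u ∈ W, ∃ v : Z → ZMod 2, ∀ y, v (p y) = u y) :
    Module.finrank (ZMod 2) W ≤ Nat.card Z := by
  cases nonempty_fintype Z
  have hle : W ≤ LinearMap.range (LinearMap.funLeft (ZMod 2) (ZMod 2) p) := fun u hu => by
    obtain ⟨v, hv⟩ := hW u hu
    exact ⟨v, funext hv⟩
  refine (Submodule.finrank_mono hle).trans ((LinearMap.finrank_range_le _).trans ?_)
  rw [Module.finrank_fintype_fun_eq_card, Nat.card_eq_fintype_card]

/-! ### Planarity gives a checkerboard colouring. -/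

namespace OrientedLinkDiagram

variable {X : Type*} [Fintype X] (D : OrientedLinkDiagram X)

theorem opp_ne (h : HalfEdge X) : D.opp h ≠ h := fun e => by
  have := D.outgoing_opp h
  rw [e] at this
  exact iff_not_self this

/-- The faces of a link diagram have a checkerboard colouring. -/
theorem exists_checkerboard :
    ∃ c : HalfEdge X → ZMod 2, (∀ h, c (D.opp h) = c h + 1) ∧ ∀ h, c (rot h) = c h + 1 := by
  classical
  set E := Pieces {D.opp} with hE
  set Φ := Pieces {fun h => rot (D.opp h)} with hΦ
  set C := Pieces {D.opp, rot} with hC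
  have h2 : ∀ a : ZMod 2, a + a = 0 := by decide
  have h4 : ∀ a b c e : ZMod 2, a + b + (b + c) + (c + e) + (e + a) = 0 := by decide
  have := Fintype.ofFinite E
  have := Fintype.ofFinite Φ
  -- `M` is the mod 2 boundary map from edges to crossings; `d` below goes from faces to edges.
  -- Euler's formula will show that homology in the middle vanishes.
  let M : Matrix X E (ZMod 2) :=
    Matrix.of fun x e => ∑ i : Fin 4, if Pieces.mk _ (x, i) = e then 1 else 0
  have hMx : ∀ x e, M x e = ∑ i : Fin 4, if Pieces.mk _ (x, i) = e then 1 else 0 := fun _ _ => rfl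
  have hM : ∀ g : E → ZMod 2, ∀ x, M.mulVecLin g x = ∑ i : Fin 4, g (Pieces.mk _ (x, i)) := by
    intro g x
    simp only [hMx, Matrix.mulVecLin_apply, Matrix.mulVec, dotProduct, Finset.sum_mul, ite_mul,
      one_mul, zero_mul]
    rw [Finset.sum_comm]
    exact Finset.sum_congr rfl fun i _ =>
      (Finset.sum_ite_eq _ _ _).trans (if_pos (Finset.mem_univ _))
  have hMT : ∀ u : X → ZMod 2, ∀ h : HalfEdge X,
      M.transpose.mulVecLin u (Pieces.mk _ h) = u h.1 + u (D.opp h).1 := by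
    intro u h
    have key : ∀ h' : HalfEdge X, Pieces.mk {D.opp} h' = Pieces.mk {D.opp} h ↔
        h' = h ∨ h' = D.opp h := by
      intro h'
      constructor
      · intro e
        have := SamePiece.apply_eq (φ := fun a => a = h ∨ a = D.opp h) (F := {D.opp}) (by
          rintro f rfl a
          rw [eq_iff_iff]
          constructor
          · rintro (rfl | e)
            · exact .inr (D.opp_opp _).symm
            · exact .inl (by rw [← D.opp_opp a, e, D.opp_opp])
          · rintro (rfl | rfl)
            · exact .inr rfl
            · exact .inl (D.opp_opp _)) (Pieces.mk_eq_mk.1 e)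
        simp [this]
      · rintro (rfl | rfl)
        · rfl
        · exact Pieces.mk_apply (Set.mem_singleton D.opp) _
    have e1 : M.transpose.mulVecLin u (Pieces.mk _ h)
        = ∑ h' : HalfEdge X, if h' = h ∨ h' = D.opp h then u h'.1 else 0 := by
      rw [Fintype.sum_prod_type]
      simp only [hMx, Matrix.mulVecLin_apply, Matrix.mulVec, Matrix.transpose_apply, dotProduct,
        Finset.sum_mul, ite_mul, one_mul, zero_mul, key]
    rw [e1, ← Finset.sum_filter, Finset.filter_or, Finset.filter_eq', Finset.filter_eq',
      if_pos (Finset.mem_univ _), if_pos (Finset.mem_univ _), Finset.sum_union, Finset.sum_singleton,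
      Finset.sum_singleton]
    simpa using (D.opp_ne h).symm
  have hkT : Module.finrank (ZMod 2) (LinearMap.ker M.transpose.mulVecLin) ≤ Nat.card C := by
    refine finrank_le_card_of_forall_exists_comp (fun x => Pieces.mk {D.opp, rot} (x, 0)) ?_
    intro u hu
    obtain ⟨v, hv⟩ := Pieces.exists_comp_mk (F := {D.opp, rot})
      (φ := fun h : HalfEdge X => u h.1) (by
        rintro f (rfl | rfl) h
        · have := hMT u h
          rw [LinearMap.mem_ker.1 hu, Pi.zero_apply] at this
          exact (add_left_cancel (a := u h.1) (by rw [h2, ← this])).symm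
        · rfl)
    exact ⟨v, fun x => hv _⟩
  let d : (Φ → ZMod 2) →ₗ[ZMod 2] (E → ZMod 2) :=
    { toFun := fun f => Quotient.lift
        (fun h => f (Pieces.mk _ h) + f (Pieces.mk _ (D.opp h))) (fun a b h => by
          refine SamePiece.apply_eq (F := {D.opp})
            (φ := fun h => f (Pieces.mk _ h) + f (Pieces.mk _ (D.opp h))) ?_ h
          rintro _ rfl h
          simp only [D.opp_opp, add_comm])
      map_add' := fun f g => by
        funext e; obtain ⟨h, rfl⟩ := Pieces.mk_surjective e
        exact add_add_add_comm _ _ _ _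
      map_smul' := fun r f => by
        funext e; obtain ⟨h, rfl⟩ := Pieces.mk_surjective e
        exact (mul_add _ _ _).symm }
  have hd : ∀ f h, d f (Pieces.mk _ h) = f (Pieces.mk _ h) + f (Pieces.mk _ (D.opp h)) :=
    fun f h => rfl
  have hrot : ∀ h, Pieces.mk {fun h => rot (D.opp h)} (D.opp h) = Pieces.mk _ (rot h) := fun h => by
    have := Pieces.mk_apply (F := {fun h => rot (D.opp h)}) (f := fun h => rot (D.opp h)) rfl
      (D.opp h)
    simp only [D.opp_opp] at this
    exact this.symm
  have hkd : Module.finrank (ZMod 2) (LinearMap.ker d) ≤ Nat.card C := by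
    obtain ⟨m, hm⟩ := Pieces.exists_comp_mk (F := {fun h => rot (D.opp h)})
      (φ := Pieces.mk {D.opp, rot}) (by
        rintro f rfl h
        exact (Pieces.mk_apply (by simp) _).trans (Pieces.mk_apply (by simp) _))
    refine finrank_le_card_of_forall_exists_comp m ?_
    intro f hf
    have hf' : ∀ h, f (Pieces.mk _ (D.opp h)) = f (Pieces.mk _ h) := fun h => by
      have := hd f h
      rw [LinearMap.mem_ker.1 hf, Pi.zero_apply] at this
      exact (add_left_cancel (a := f (Pieces.mk _ h)) (by rw [h2, ← this])).symm
    obtain ⟨v, hv⟩ := Pieces.exists_comp_mk (F := {D.opp, rot})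
      (φ := fun h => f (Pieces.mk _ h)) (by
        rintro _ (rfl | rfl) h
        · exact hf' h
        · rw [← hrot, hf'])
    refine ⟨v, fun y => ?_⟩
    obtain ⟨h, rfl⟩ := Pieces.mk_surjective y
    rw [hm, hv]
  have hle : LinearMap.range d ≤ LinearMap.ker M.mulVecLin := by
    rintro _ ⟨f, rfl⟩
    rw [LinearMap.mem_ker]
    funext x
    rw [hM]
    have hdr : ∀ i : Fin 4,
        d f (Pieces.mk _ (x, i)) = f (Pieces.mk _ (x, i)) + f (Pieces.mk _ (x, i + 1)) :=
      fun i => by rw [hd, hrot]; rfl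
    simp only [hdr, Fin.sum_univ_four, Pi.zero_apply,
      show (0 : Fin 4) + 1 = 1 from rfl, show (1 : Fin 4) + 1 = 2 from rfl,
      show (2 : Fin 4) + 1 = 3 from rfl,
      show (3 : Fin 4) + 1 = 0 from rfl]
    exact h4 _ _ _ _
  have hMrank : M.rank = M.transpose.rank := (Matrix.rank_transpose M).symm
  have r1 := LinearMap.finrank_range_add_finrank_ker M.mulVecLin
  have r2 := LinearMap.finrank_range_add_finrank_ker M.transpose.mulVecLin
  have r3 := LinearMap.finrank_range_add_finrank_ker d
  rw [Module.finrank_fintype_fun_eq_card] at r1 r2 r3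
  have hp := D.planar
  rw [← hE, ← hΦ, ← hC, Nat.card_eq_fintype_card (α := E), Nat.card_eq_fintype_card (α := Φ)] at hp
  simp only [Matrix.rank] at hMrank
  -- With V, E, F, C as in `planar`: the kernels of `M.transpose` and `d` have dimension at most C,
  -- so dim ker M ≤ E - V + C and dim range d ≥ F - C. Euler's formula equates these bounds.
  have heq : LinearMap.range d = LinearMap.ker M.mulVecLin :=
    Submodule.eq_of_le_of_finrank_le hle (by omega)
  -- The sum of all edges is a cycle because every crossing has even degree. A face function
  -- bounding it changes across every edge, which makes it the colouring.
  have h1 : (1 : E → ZMod 2) ∈ LinearMap.range d := by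
    rw [heq, LinearMap.mem_ker]
    funext x
    rw [hM]
    exact show ∑ _ : Fin 4, (1 : ZMod 2) = 0 by decide
  obtain ⟨f, hf⟩ := h1
  have hopp : ∀ h, f (Pieces.mk _ (D.opp h)) = f (Pieces.mk _ h) + 1 := fun h => by
    have := hd f h
    rw [hf, Pi.one_apply] at this
    rw [this, ← add_assoc, h2, zero_add]
  exact ⟨fun h => f (Pieces.mk _ h), hopp, fun h => (congrArg f (hrot h)).symm.trans (hopp h)⟩

end OrientedLinkDiagram

/-! ### How relabelling crossings changes the circles. -/

namespace OrientedLinkDiagram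

variable {X : Type*}

/-- Invariance under the smoothing arcs of a state carries over to a second state if it is known
that the function agrees on the chord ends at all crossings where the states differ. -/
theorem smooth_invariant {β : Type*} {φ : HalfEdge X → β} {s s' : X → CrossingLabel}
    (hφ : ∀ h, φ (smooth s h) = φ h) (hs : ∀ y, s y = s' y ∨ φ (y, 0) = φ (y, 2))
    (h : HalfEdge X) : φ (smooth s' h) = φ h := by
  obtain ⟨y, i⟩ := h
  rcases hs y with hy | h02
  · simpa only [smooth, hy] using hφ (y, i)
  · have h0 := hφ (y, 0)
    have h2 := hφ (y, 2)
    cases e : s y <;> cases e' : s' y <;> fin_cases i <;>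
      simp_all [smooth, CrossingLabel.partner]

open Classical in
/-- The smoothing arcs of a state, without the two arcs at the crossing `x`. -/
noncomputable def cutSmoothAt (s : X → CrossingLabel) (x : X) (h : HalfEdge X) : HalfEdge X :=
  if h.1 = x then h else smooth s h

theorem cutSmoothAt_stateA (x : X) : cutSmoothAt stateA x = cutSmooth x := rfl

theorem smooth_smooth (s : X → CrossingLabel) (h : HalfEdge X) : smooth s (smooth s h) = h := by
  obtain ⟨y, i⟩ := h
  cases e : s y <;> fin_cases i <;> simp [smooth, e, CrossingLabel.partner]

theorem color_smooth {c : HalfEdge X → ZMod 2} (hc : ∀ h, c (rot h) = c h + 1)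
    (s : X → CrossingLabel) (h : HalfEdge X) : c (smooth s h) = c h + 1 := by
  obtain ⟨y, i⟩ := h
  have h2 : ∀ a : ZMod 2, a + 1 + 1 = a := by decide
  have h0 : c (y, 1) = c (y, 0) + 1 := hc (y, 0)
  have h1 : c (y, 2) = c (y, 1) + 1 := hc (y, 1)
  have h3 : c (y, 3) = c (y, 2) + 1 := hc (y, 2)
  cases e : s y <;> fin_cases i <;> simp [smooth, e, CrossingLabel.partner, h0, h1, h3, h2]

/-- The labelling with `B` exactly on `T`. -/
noncomputable def labelOn (s : X → CrossingLabel) (T : Finset X) : X → CrossingLabel :=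
  open Classical in fun x => if x ∈ T then .B else s x

theorem labelOn_of_mem {s : X → CrossingLabel} {T : Finset X} {x : X} (h : x ∈ T) :
    labelOn s T x = .B := if_pos h

theorem labelOn_of_notMem {s : X → CrossingLabel} {T : Finset X} {x : X} (h : x ∉ T) :
    labelOn s T x = s x := if_neg h

variable [Fintype X] (D : OrientedLinkDiagram X)

theorem numCircles_eq (s : X → CrossingLabel) :
    D.numCircles s = Nat.card (Pieces {D.opp, smooth s}) + D.loops := by
  rw [numCircles, ← Nat.card_eq_fintype_card, Nat.card_sum, Nat.card_fin]

/-- Relabelling one crossing creates at most one circle, and creates one only if the ends of the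
chord at the crossing lie on the same circle. -/
theorem numCircles_le_of_eq_off {s s' : X → CrossingLabel} {x : X}
    (hs : ∀ y, y ≠ x → s y = s' y) (hx : s x = .B) (hx' : s' x = .A) :
    D.numCircles s ≤ D.numCircles s' + 1 ∧ (D.numCircles s = D.numCircles s' + 1 →
      SamePiece {D.opp, smooth s'} (x, 0) (x, 2)) := by
  simp only [numCircles_eq]
  -- Both smoothings are compared with the gluing by `smooth s` and `smooth s'` together, which is
  -- coarser than either.
  have h1 : Nat.card (Pieces {D.opp, smooth s}) ≤
      Nat.card (Pieces {D.opp, smooth s, smooth s'}) + 1 := by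
    refine Pieces.card_le_add_one (x, 0) (x, 2) fun φ hφ h02 g hg c => ?_
    obtain rfl | rfl | rfl := hg
    · exact hφ _ (by simp) c
    · exact hφ _ (by simp) c
    · exact smooth_invariant (hφ _ (by simp))
        (fun y => (eq_or_ne y x).elim (fun e => .inr (e ▸ h02)) fun e => .inl (hs y e)) c
  have hsub : ({D.opp, smooth s'} : Set _) ⊆ {D.opp, smooth s, smooth s'} := by
    rintro f (rfl | rfl) <;> simp
  have h2 := Pieces.card_le_of_subset hsub
  -- A gain of one circle forces the gluing by `s'` alone to have as many pieces as the joint one,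
  -- in which 0 is joined to 1 by `s'` and 1 to 2 by `s`.
  refine ⟨by omega, fun he => Pieces.samePiece_of_card_le hsub (by omega) ?_⟩
  have h01 : smooth s' (x, 0) = (x, 1) := by simp [smooth, hx', CrossingLabel.partner]
  have h12 : smooth s (x, 1) = (x, 2) := by simp [smooth, hx, CrossingLabel.partner]
  rw [← h12, ← h01]
  exact (SamePiece.of_mem (by simp) _).trans (SamePiece.of_mem (by simp) _)

/-- If the ends of the chord at an `A`-labelled crossing `x` lie on the same circle, then the
chord cuts this circle into two arcs, one from `(x, 0)` to `(x, 3)` and one from `(x, 1)` to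
`(x, 2)`. -/
theorem exists_arc {s : X → CrossingLabel} {x : X} (hx : s x = .A) (i : Fin 4)
    (h : SamePiece {D.opp, smooth s} (x, i) (x, i + 2)) :
    ∃ K : Set (HalfEdge X), (∀ h, D.opp h ∈ K ↔ h ∈ K) ∧ (∀ h, cutSmoothAt s x h ∈ K ↔ h ∈ K) ∧
      (∀ k, (x, k) ∈ K ↔ k = i ∨ k = CrossingLabel.B.partner i) ∧
      SamePiece {D.opp, cutSmoothAt s x} (x, i) (x, CrossingLabel.B.partner i) := by
  obtain ⟨c, hopp, hrot⟩ := D.exists_checkerboard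
  have hself : ∀ k, cutSmoothAt s x (x, k) = (x, k) := fun k => if_pos rfl
  have hoff : ∀ h : HalfEdge X, h.1 ≠ x → cutSmoothAt s x h = smooth s h := fun h hh => if_neg hh
  have hinv : ∀ h, cutSmoothAt s x (cutSmoothAt s x h) = h := fun h => by
    by_cases hh : h.1 = x
    · obtain ⟨y, k⟩ := h
      obtain rfl : y = x := hh
      rw [hself, hself]
    · rw [hoff h hh, hoff (smooth s h) hh, smooth_smooth]
  obtain ⟨K, b, haK, hbK, hb, hcb, hK1, hK2, hends, hconn⟩ :=
    exists_other_end D.opp_opp hinv (hself i) hopp (fun h hh => by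
      by_cases hx' : h.1 = x
      · exact absurd (if_pos hx') hh
      · rw [hoff h hx', color_smooth hrot])
  have hK1' : ∀ h, D.opp h ∈ K ↔ h ∈ K :=
    fun h => ⟨fun hh => by simpa only [D.opp_opp] using hK1 _ hh, hK1 h⟩
  have hK2' : ∀ h, cutSmoothAt s x h ∈ K ↔ h ∈ K :=
    fun h => ⟨fun hh => by simpa only [hinv] using hK2 _ hh, hK2 h⟩
  have hbx : b.1 = x := by
    by_contra hne
    rw [hoff b hne] at hb
    have := color_smooth hrot s b
    rw [hb] at this
    simp at this
  obtain ⟨y, j⟩ := b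
  obtain rfl : y = x := hbx
  have hmem : ∀ k, (y, k) ∈ K ↔ k = i ∨ k = j := fun k => by
    refine ⟨fun hk => ?_, ?_⟩
    · simpa using hends _ hk (hself k)
    · rintro (rfl | rfl) <;> assumption
  -- The two ends have opposite colours, and colours alternate around the crossing, so `i` and `j`
  -- are neighbouring positions.
  have hj : j = CrossingLabel.A.partner i ∨ j = CrossingLabel.B.partner i := by
    have h0 : c (y, 1) = c (y, 0) + 1 := hrot (y, 0)
    have h1 : c (y, 2) = c (y, 1) + 1 := hrot (y, 1)
    have h3 : c (y, 3) = c (y, 2) + 1 := hrot (y, 2)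
    have h2 : ∀ a : ZMod 2, a + 1 + 1 = a := by decide
    clear * - h0 h1 h3 h2 hcb
    fin_cases i <;> fin_cases j <;> simp_all [CrossingLabel.partner]
  -- An end at the `A`-partner would be closed up by the `A`-arc to a circle missing `(x, i + 2)`,
  -- against `h`.
  rcases hj with rfl | rfl
  · exfalso
    have hi2 := SamePiece.apply_eq (φ := fun h => h ∈ K) (by
      rintro f (rfl | rfl) h
      · exact propext (hK1' h)
      · by_cases hh : h.1 = y
        · obtain ⟨z, k⟩ := h
          obtain rfl : z = y := hh
          simp only [smooth, hx, hmem, eq_iff_iff]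
          clear * -
          revert i k
          decide
        · simpa only [hoff h hh] using propext (hK2' h)) h
    simp only [hmem, true_or, eq_iff_iff, true_iff] at hi2
    revert hi2
    clear * -
    revert i
    decide
  · exact ⟨K, hK1', hK2', hmem, hconn _ hbK⟩

/-- A lower bound for the number of circles after relabelling, by linear independence of the
indicator functions of the circles and of functions `f x` that jump only at the chord of `x`. -/
theorem numCircles_add_card_le {s : X → CrossingLabel} {T : Finset X} (hT : ∀ x ∈ T, s x = .A)
    (hadm : ∀ x ∈ T, SamePiece {D.opp, smooth s} (x, 0) (x, 2))
    (f : T → HalfEdge X → ZMod 2) (hf₁ : ∀ x h, f x (D.opp h) = f x h)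
    (hf₂ : ∀ x h, f x (smooth (labelOn s T) h) = f x h)
    (hf₃ : ∀ x : T, f x (x, 0) ≠ f x (x, 1))
    (hf₄ : ∀ x y : T, x ≠ y → f x (y, 0) = f x (y, 1)) :
    D.numCircles s + T.card ≤ D.numCircles (labelOn s T) := by
  classical
  have := Fintype.ofFinite (Pieces {D.opp, smooth s})
  let Φ : ((Pieces {D.opp, smooth s} → ZMod 2) × (T → ZMod 2)) →ₗ[ZMod 2]
      (HalfEdge X → ZMod 2) :=
    (LinearMap.funLeft (ZMod 2) (ZMod 2) (Pieces.mk {D.opp, smooth s})).coprod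
      (Fintype.linearCombination (ZMod 2) f)
  have hΦ : ∀ p h, Φ p h = p.1 (Pieces.mk _ h) + ∑ x, p.2 x * f x h := fun p h => by
    simp [Φ, LinearMap.funLeft_apply, Fintype.linearCombination_apply]
  have hmk01 : ∀ x ∈ T, Pieces.mk {D.opp, smooth s} (x, 1) = Pieces.mk _ (x, 0) := fun x hx => by
    have h01 : smooth s (x, 0) = (x, 1) := by simp [smooth, hT x hx, CrossingLabel.partner]
    rw [← h01]
    exact Pieces.mk_apply (by simp) _
  have hinj : Function.Injective Φ := by
    rw [← LinearMap.ker_eq_bot, LinearMap.ker_eq_bot']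
    rintro ⟨g, a⟩ h0
    have hz : ∀ h, g (Pieces.mk _ h) + ∑ x, a x * f x h = 0 := fun h => by
      rw [← hΦ (g, a), h0, Pi.zero_apply]
    -- Comparing the values at `(y, 0)` and `(y, 1)` isolates `a y`: these points share a circle of
    -- `s`, and only `f y` distinguishes them.
    have ha : a = 0 := by
      funext y
      have h1 := (hz (y, 0)).trans (hz (y, 1)).symm
      rw [hmk01 y y.2] at h1
      have h2 := add_left_cancel h1
      rw [← sub_eq_zero, ← Finset.sum_sub_distrib, Finset.sum_eq_single y] at h2
      · rw [← mul_sub, mul_eq_zero, sub_eq_zero] at h2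
        exact h2.resolve_right (hf₃ y)
      · intro x _ hxy
        rw [hf₄ x y hxy, sub_self]
      · simp
    subst ha
    refine Prod.ext (funext fun e => ?_) rfl
    obtain ⟨h, rfl⟩ := Pieces.mk_surjective e
    simpa using hz h
  have hrange : Module.finrank (ZMod 2) (LinearMap.range Φ) ≤
      Nat.card (Pieces {D.opp, smooth (labelOn s T)}) := by
    refine finrank_le_card_of_forall_exists_comp (Pieces.mk _) ?_
    rintro _ ⟨p, rfl⟩
    refine Pieces.exists_comp_mk ?_
    have hopp : ∀ h, Φ p (D.opp h) = Φ p h := fun h => by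
      simp only [hΦ, hf₁, Pieces.mk_apply (F := {D.opp, smooth s}) (f := D.opp) (by simp)]
    rintro _ (rfl | rfl) h
    · exact hopp h
    · have hg : Pieces.mk {D.opp, smooth s} (smooth (labelOn s T) h) = Pieces.mk _ h := by
        refine smooth_invariant (s := s) (fun h => Pieces.mk_apply (by simp) h) (fun y => ?_) h
        by_cases hy : y ∈ T
        · exact .inr (Pieces.mk_eq_mk.2 (hadm y hy))
        · exact .inl (labelOn_of_notMem hy).symm
      simp only [hΦ, hf₂, hg]
  rw [LinearMap.finrank_range_of_inj hinj, Module.finrank_prod,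
    Module.finrank_fintype_fun_eq_card, Module.finrank_fintype_fun_eq_card, Fintype.card_coe,
    ← Nat.card_eq_fintype_card] at hrange
  simp only [numCircles_eq]
  omega

/-- An arc cut off by the chord at `x` gives a function that jumps only at this chord. -/
theorem exists_jump {s : X → CrossingLabel} {x : X} (hx : s x = .A)
    (h : SamePiece {D.opp, smooth s} (x, 0) (x, 2)) :
    ∃ f : HalfEdge X → ZMod 2, (∀ h, f (D.opp h) = f h) ∧
      (∀ h, f (cutSmoothAt s x h) = f h) ∧ f (x, 0) ≠ f (x, 1) ∧ f (x, 0) = f (x, 3) ∧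
      f (x, 1) = f (x, 2) := by
  classical
  obtain ⟨K, h1, h2, h3, -⟩ := D.exists_arc hx 0 h
  refine ⟨fun h => if h ∈ K then 1 else 0, fun h => by simp only [h1], fun h => by simp only [h2],
    ?_, ?_, ?_⟩ <;> simp [h3, CrossingLabel.partner]

theorem numCircles_add_one_le {s : X → CrossingLabel} {x : X} (hx : s x = .A)
    (h : SamePiece {D.opp, smooth s} (x, 0) (x, 2)) :
    D.numCircles s + 1 ≤ D.numCircles (labelOn s {x}) := by
  obtain ⟨f, h1, h2, h3, h4, h5⟩ := D.exists_jump hx h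
  have key := D.numCircles_add_card_le (s := s) (T := {x}) (by simpa using hx) (by simpa using h)
    (fun _ => f) (fun _ => h1) ?_ ?_ ?_
  · simpa using key
  · rintro - ⟨y, i⟩
    by_cases hy : y = x
    · subst hy
      simp only [smooth, labelOn_of_mem (Finset.mem_singleton_self y)]
      fin_cases i <;> simp [CrossingLabel.partner, h4, h5]
    · have := h2 (y, i)
      simp only [cutSmoothAt, hy, if_false] at this
      simpa only [smooth, labelOn_of_notMem (T := {x}) (s := s) (x := y) (by simpa using hy)]
        using this
  · rintro ⟨y, hy⟩
    obtain rfl := Finset.mem_singleton.1 hy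
    exact h3
  · rintro ⟨y, hy⟩ ⟨z, hz⟩ hyz
    obtain rfl := Finset.mem_singleton.1 hy
    obtain rfl := Finset.mem_singleton.1 hz
    exact absurd rfl hyz

/-- If the ends of the chord at `x` lie on the same circle, then relabelling `x` has the same effect
on the pieces as cutting at `x`. -/
theorem samePiece_cutSmoothAt {s : X → CrossingLabel} {x : X} (hx : s x = .A)
    (h : SamePiece {D.opp, smooth s} (x, 0) (x, 2)) {a b : HalfEdge X} :
    SamePiece {D.opp, cutSmoothAt s x} a b ↔ SamePiece {D.opp, smooth (labelOn s {x})} a b := by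
  obtain ⟨-, -, -, -, h03⟩ := D.exists_arc hx 0 h
  obtain ⟨-, -, -, -, h21⟩ := D.exists_arc hx 2 h.symm
  have hoff : ∀ y ≠ x, ∀ i, smooth (labelOn s {x}) (y, i) = cutSmoothAt s x (y, i) :=
    fun y hy i => by
      simp only [smooth, labelOn_of_notMem (T := {x}) (s := s) (x := y) (by simpa using hy),
        cutSmoothAt, hy, if_false]
  -- Away from `x` the two gluings agree. At `x` the `B`-arcs join 0 to 3 and 1 to 2, which the two
  -- arcs of the cut circle already connect.
  constructor <;> intro hab <;> rw [← Pieces.mk_eq_mk] <;>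
    refine SamePiece.apply_eq ?_ hab <;> rintro f (rfl | rfl) ⟨y, i⟩
  · exact Pieces.mk_apply (by simp) _
  · by_cases hy : y = x
    · simp only [cutSmoothAt, hy, if_true]
    · rw [← hoff y hy]
      exact Pieces.mk_apply (by simp) _
  · exact Pieces.mk_apply (by simp) _
  · by_cases hy : y = x
    · subst hy
      rw [Pieces.mk_eq_mk]
      simp only [smooth, labelOn_of_mem (Finset.mem_singleton_self y)]
      fin_cases i
      exacts [h03.symm, h21, h21.symm, h03]
    · rw [hoff y hy]
      exact Pieces.mk_apply (by simp) _

end OrientedLinkDiagram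

/-! ### States as sets of `B`-crossings, and when |s| = |s_A| + b(s). -/

namespace OrientedLinkDiagram

variable {X : Type*}

theorem labelOn_labelOn [DecidableEq X] (s : X → CrossingLabel) (T U : Finset X) :
    labelOn (labelOn s T) U = labelOn s (T ∪ U) := by
  funext x
  by_cases hU : x ∈ U
  · rw [labelOn_of_mem hU, labelOn_of_mem (Finset.mem_union_right _ hU)]
  · by_cases hT : x ∈ T
    · rw [labelOn_of_notMem hU, labelOn_of_mem hT, labelOn_of_mem (Finset.mem_union_left _ hT)]
    · rw [labelOn_of_notMem hU, labelOn_of_notMem hT, labelOn_of_notMem (by simp [hU, hT])]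

theorem labelOn_empty (s : X → CrossingLabel) : labelOn s ∅ = s :=
  funext fun _ => labelOn_of_notMem (Finset.notMem_empty _)

theorem labelOn_stateA_eq_B {T : Finset X} {x : X} : labelOn stateA T x = .B ↔ x ∈ T := by
  refine ⟨fun h => ?_, labelOn_of_mem⟩
  by_contra hx
  rw [labelOn_of_notMem hx] at h
  exact absurd h (by simp [stateA])

variable [Fintype X]

theorem numB_labelOn (T : Finset X) : numB (labelOn stateA T) = T.card := by
  classical
  rw [numB]
  congr 1
  ext x
  simp [labelOn_stateA_eq_B]

theorem exists_eq_labelOn (s : X → CrossingLabel) : ∃ T : Finset X, s = labelOn stateA T := by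
  classical
  refine ⟨Finset.univ.filter fun x => s x = .B, funext fun x => ?_⟩
  cases h : s x
  · rw [labelOn_of_notMem (by simp [h])]; rfl
  · rw [labelOn_of_mem (by simp [h])]

theorem numA_add_numB (s : X → CrossingLabel) : numA s + numB s = Fintype.card X := by
  classical
  have h : ∀ x, s x = .B ↔ ¬ s x = .A := fun x => by cases s x <;> simp
  simp only [numA, numB, h]
  exact Finset.card_filter_add_card_filter_not _

variable (D : OrientedLinkDiagram X)

/-- Relabelling an `A`-crossing by `B` creates at most one circle, and creates one exactly if the
ends of the chord lie on the same circle. -/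
theorem numCircles_labelOn_singleton {s : X → CrossingLabel} {x : X} (hx : s x = .A) :
    D.numCircles (labelOn s {x}) ≤ D.numCircles s + 1 ∧
      (D.numCircles (labelOn s {x}) = D.numCircles s + 1 ↔
        SamePiece {D.opp, smooth s} (x, 0) (x, 2)) := by
  obtain ⟨h1, h2⟩ := D.numCircles_le_of_eq_off (s := labelOn s {x}) (s' := s) (x := x)
    (fun y hy => labelOn_of_notMem (by simpa using hy))
    (labelOn_of_mem (Finset.mem_singleton_self x)) hx
  exact ⟨h1, h2, fun h => h1.antisymm (D.numCircles_add_one_le hx h)⟩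

theorem numCircles_labelOn_union_le [DecidableEq X] (T U : Finset X) :
    D.numCircles (labelOn stateA (T ∪ U)) ≤ D.numCircles (labelOn stateA T) + U.card := by
  induction U using Finset.induction_on with
  | empty => simp
  | insert x U hx ih =>
    rw [Finset.card_insert_of_notMem hx]
    by_cases hT : x ∈ T ∪ U
    · rw [Finset.union_insert, Finset.insert_eq_of_mem hT]
      omega
    · have := (D.numCircles_labelOn_singleton (s := labelOn stateA (T ∪ U)) (x := x)
        (labelOn_of_notMem hT)).1
      rw [labelOn_labelOn, Finset.union_assoc, Finset.union_singleton] at this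
      omega

theorem numCircles_labelOn_le (T : Finset X) :
    D.numCircles (labelOn stateA T) ≤ D.numCircles stateA + T.card := by
  classical
  simpa [labelOn_empty] using D.numCircles_labelOn_union_le ∅ T

/-- If relabelling `T` creates `T.card` circles, then so does relabelling a subset. -/
theorem numCircles_labelOn_of_subset {T U : Finset X} (hUT : U ⊆ T)
    (hT : D.numCircles (labelOn stateA T) = D.numCircles stateA + T.card) :
    D.numCircles (labelOn stateA U) = D.numCircles stateA + U.card := by
  classical
  have h1 := D.numCircles_labelOn_union_le U (T \ U)
  rw [Finset.union_sdiff_of_subset hUT] at h1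
  have h2 := D.numCircles_labelOn_le U
  have h3 := Finset.card_sdiff_add_card_eq_card hUT
  omega

theorem admissible_iff (x : X) :
    D.Admissible x ↔ D.numCircles (labelOn stateA {x}) = D.numCircles stateA + 1 :=
  (D.numCircles_labelOn_singleton rfl).2.symm

/-- Cutting at `x` has the effect of relabelling `x`, after which the ends of the chord at `y` share
a circle exactly when relabelling `y` creates another one. The resulting criterion is symmetric in
`x` and `y`, which yields `separates_comm`. -/
theorem not_separates_iff [DecidableEq X] {x y : X} (hxy : x ≠ y) (hx : D.Admissible x) :
    ¬ D.Separates x y ↔ D.numCircles (labelOn stateA {x, y}) = D.numCircles stateA + 2 := by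
  rw [Separates, not_not, ← cutSmoothAt_stateA, D.samePiece_cutSmoothAt rfl hx,
    ← (D.numCircles_labelOn_singleton (labelOn_of_notMem (by simpa using hxy.symm))).2,
    (D.admissible_iff x).1 hx, labelOn_labelOn]
  rfl

theorem separates_comm {x y : X} (hx : D.Admissible x) (hy : D.Admissible y) :
    D.Separates x y ↔ D.Separates y x := by
  classical
  rcases eq_or_ne x y with rfl | hxy
  · rfl
  · rw [← not_iff_not, D.not_separates_iff hxy hx, D.not_separates_iff hxy.symm hy, Finset.pair_comm]

theorem numCircles_labelOn_eq_iff (T : Finset X) :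
    D.numCircles (labelOn stateA T) = D.numCircles stateA + T.card ↔
      (∀ x ∈ T, D.Admissible x) ∧ ∀ x ∈ T, ∀ y ∈ T, x ≠ y → ¬ D.Separates x y := by
  classical
  constructor
  · intro hT
    have hadm : ∀ x ∈ T, D.Admissible x := fun x hx => by
      rw [admissible_iff]
      exact D.numCircles_labelOn_of_subset (Finset.singleton_subset_iff.2 hx) hT
    refine ⟨hadm, fun x hx y hy hxy => ?_⟩
    rw [D.not_separates_iff hxy (hadm x hx), ← Finset.card_pair hxy]
    exact D.numCircles_labelOn_of_subset (by simp [Finset.insert_subset_iff, hx, hy]) hT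
  · rintro ⟨hadm, hsep⟩
    refine (D.numCircles_labelOn_le T).antisymm ?_
    choose f hf₁ hf₂ hf₃ hf₄ hf₅ using fun x : T =>
      D.exists_jump (s := stateA) (x := x) rfl (hadm x x.2)
    have hoff : ∀ (x : T) (y : X) (i : Fin 4), y ≠ x →
        f x (smooth stateA (y, i)) = f x (y, i) := fun x y i hy => by
      simpa only [cutSmoothAt, hy, if_false] using hf₂ x (y, i)
    -- The arc indicator of `x` is constant on the pieces of s_A D cut at `x`, and the chord at `y`
    -- has both ends on one such piece.
    have h02 : ∀ x y : T, x ≠ y → f x (y, 0) = f x (y, 2) := fun x y hxy => by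
      have h := hsep x x.2 y y.2 (Subtype.coe_injective.ne hxy)
      rw [Separates, not_not, ← cutSmoothAt_stateA] at h
      refine SamePiece.apply_eq ?_ h
      rintro _ (rfl | rfl) h
      exacts [hf₁ x h, hf₂ x h]
    have h01 : ∀ x y : T, x ≠ y → f x (y, 0) = f x (y, 1) := fun x y hxy =>
      (hoff x y 0 (Subtype.coe_injective.ne hxy.symm)).symm
    have h23 : ∀ x y : T, x ≠ y → f x (y, 2) = f x (y, 3) := fun x y hxy =>
      (hoff x y 2 (Subtype.coe_injective.ne hxy.symm)).symm
    refine D.numCircles_add_card_le (fun _ _ => rfl) hadm f hf₁ ?_ hf₃ h01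
    rintro x ⟨y, i⟩
    by_cases hy : y ∈ T
    · have h03 : f x (y, 0) = f x (y, 3) ∧ f x (y, 1) = f x (y, 2) := by
        by_cases hxy : x = ⟨y, hy⟩
        · subst hxy
          exact ⟨hf₄ _, hf₅ _⟩
        · have e1 := h02 x ⟨y, hy⟩ hxy
          have e2 := h01 x ⟨y, hy⟩ hxy
          have e3 := h23 x ⟨y, hy⟩ hxy
          exact ⟨e1.trans e3, e2.symm.trans e1⟩
      simp only [smooth, labelOn_of_mem hy]
      fin_cases i <;> simp [CrossingLabel.partner, h03.1, h03.2]
    · have := hoff x y i (fun e => hy (e ▸ x.2))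
      simpa only [smooth, labelOn_of_notMem hy] using this

/-! ### The minimum of j. -/

variable {D}

namespace EnhancedState

theorem neg_numCircles_le_tau (s : D.EnhancedState) : -(D.numCircles s.label : ℤ) ≤ s.tau := by
  have h : ∑ _c : D.Circle s.label, (-1 : ℤ) ≤ s.tau := Finset.sum_le_sum fun c _ => by
    rcases Int.units_eq_one_or (s.sign c) with h | h <;> rw [h] <;> decide
  simpa [numCircles] using h

theorem tau_eq_iff (s : D.EnhancedState) :
    s.tau = -(D.numCircles s.label : ℤ) ↔ s.sign = fun _ => -1 := by
  constructor
  · intro h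
    have h' : ∑ _c : D.Circle s.label, (-1 : ℤ) = ∑ c, (s.sign c : ℤ) := by
      simpa [numCircles, tau] using h.symm
    rw [Finset.sum_eq_sum_iff_of_le] at h'
    · funext c
      exact Units.ext (h' c (Finset.mem_univ c)).symm
    · intro c _
      rcases Int.units_eq_one_or (s.sign c) with h | h <;> rw [h] <;> decide
  · intro h
    simp [tau, h, numCircles]

/-- Since a(s) = n - b(s) for n crossings, the numerator of i(s) is w - n + 2 b(s). The even term
leaves the integer division exactly, whatever the parity of w - n. -/
theorem jDeg_eq (s : D.EnhancedState) :
    s.jDeg = D.writhe + (D.writhe - Fintype.card X) / 2 + numB s.label + s.tau := by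
  have h := numA_add_numB s.label
  have e : D.writhe - ((numA s.label : ℤ) - numB s.label) =
      (D.writhe - Fintype.card X) + numB s.label * 2 := by
    rw [← h]; push_cast; ring
  rw [jDeg, iDeg, e, Int.add_mul_ediv_right _ _ two_ne_zero]
  ring

end EnhancedState

theorem numCircles_le (s : X → CrossingLabel) :
    D.numCircles s ≤ D.numCircles stateA + numB s := by
  obtain ⟨T, rfl⟩ := exists_eq_labelOn s
  rw [numB_labelOn]
  exact D.numCircles_labelOn_le T

theorem mem_Smin_iff (s : D.EnhancedState) :
    s ∈ D.Smin ↔ D.numCircles s.label = D.numCircles stateA + numB s.label ∧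
      s.sign = fun _ => -1 := by
  rw [← s.tau_eq_iff]
  rfl

theorem Smin_eq_setOf_jDeg_le :
    D.Smin = {s : D.EnhancedState | ∀ t : D.EnhancedState, s.jDeg ≤ t.jDeg} := by
  ext s
  have hs1 := s.neg_numCircles_le_tau
  have hs2 := numCircles_le (D := D) s.label
  simp only [Smin, Set.mem_ofPred_eq, EnhancedState.jDeg_eq]
  constructor
  · rintro ⟨h1, h2⟩ t
    have ht1 := t.neg_numCircles_le_tau
    have ht2 := numCircles_le (D := D) t.label
    omega
  · intro h
    -- Minimality against the all-minus state on s_A gives b(s) + τ(s) ≤ -|s_A|, which forces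
    -- equality in both `hs1` and `hs2`.
    have h0 := h ⟨stateA, fun _ => -1⟩
    rw [(EnhancedState.tau_eq_iff ⟨stateA, fun _ => -1⟩).2 rfl] at h0
    have hA : numB (stateA : X → CrossingLabel) = 0 := by simp [numB, stateA]
    simp only [hA] at h0
    omega

/-! ### The bijection with independent sets. -/

variable (D)

theorem bijOn_vertexSet :
    Set.BijOn (fun s : D.EnhancedState => s.vertexSet) D.Smin
      {C : Set {x : X // D.Admissible x} | D.landoGraph.IsIndepSet C} ∧
    ∀ s ∈ D.Smin, s.vertexSet.ncard = numB s.label := by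
  classical
  -- All `B`-crossings of a state in `Smin` are vertices of the Lando graph, so `vertexSet` loses
  -- none of them. Injectivity and the count both rest on this.
  have hadm : ∀ s ∈ D.Smin, ∀ x, s.label x = .B → D.Admissible x := by
    rintro ⟨l, σ⟩ hs x hx
    obtain ⟨T, rfl⟩ := exists_eq_labelOn l
    have h := hs.1
    rw [numB_labelOn] at h
    exact ((D.numCircles_labelOn_eq_iff T).1 h).1 x (labelOn_stateA_eq_B.1 hx)
  refine ⟨⟨?_, ?_, ?_⟩, ?_⟩
  · rintro ⟨l, σ⟩ hs x hx y hy hxy hadj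
    obtain ⟨T, rfl⟩ := exists_eq_labelOn l
    have h := hs.1
    rw [numB_labelOn] at h
    exact ((D.numCircles_labelOn_eq_iff T).1 h).2 x (labelOn_stateA_eq_B.1 hx) y
      (labelOn_stateA_eq_B.1 hy) (Subtype.coe_injective.ne hxy) hadj.2.1
  · rintro ⟨l, σ⟩ hs ⟨l', σ'⟩ hs' hV
    have hl : l = l' := by
      funext x
      have hB : l x = .B ↔ l' x = .B :=
        ⟨fun h => (Set.ext_iff.1 hV ⟨x, hadm _ hs x h⟩).1 h,
          fun h => (Set.ext_iff.1 hV ⟨x, hadm _ hs' x h⟩).2 h⟩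
      cases h : l x <;> cases h' : l' x <;> simp_all
    subst hl
    have h1 := ((mem_Smin_iff _).1 hs).2
    have h2 := ((mem_Smin_iff _).1 hs').2
    simp only at h1 h2
    rw [h1, h2]
  · intro C hC
    let T : Finset X := C.toFinite.toFinset.map (Function.Embedding.subtype _)
    have hT : ∀ x, x ∈ T ↔ ∃ h : D.Admissible x, (⟨x, h⟩ : {x // D.Admissible x}) ∈ C := by
      simp [T]
    refine ⟨⟨labelOn stateA T, fun _ => -1⟩, (mem_Smin_iff _).2 ⟨?_, rfl⟩, ?_⟩
    · rw [numB_labelOn]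
      refine (D.numCircles_labelOn_eq_iff T).2 ⟨fun x hx => ((hT x).1 hx).1, ?_⟩
      intro x hx y hy hxy hsep
      obtain ⟨hx, hxC⟩ := (hT x).1 hx
      obtain ⟨hy, hyC⟩ := (hT y).1 hy
      have hne : (⟨x, hx⟩ : {x // D.Admissible x}) ≠ ⟨y, hy⟩ := fun e => hxy (congrArg Subtype.val e)
      exact hC hxC hyC hne ⟨hne, hsep, (D.separates_comm hx hy).1 hsep⟩
    · ext ⟨x, hx⟩
      refine labelOn_stateA_eq_B.trans ((hT x).trans ⟨fun h => h.2, fun h => ⟨hx, h⟩⟩)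
  · intro s hs
    rw [← Set.ncard_image_of_injective _ Subtype.val_injective, numB, ← Set.ncard_coe_finset]
    congr 1
    ext x
    simp only [Set.mem_image, Finset.coe_filter, Finset.mem_univ, true_and, Set.mem_ofPred_eq]
    constructor
    · rintro ⟨y, hy, rfl⟩
      exact hy
    · exact fun hx => ⟨⟨x, hadm s hs x hx⟩, hx, rfl⟩

end OrientedLinkDiagram

theorem proposition4p2 {X : Type*} [Fintype X] (D : OrientedLinkDiagram X) :
    D.Smin = {s : D.EnhancedState | ∀ t : D.EnhancedState, s.jDeg ≤ t.jDeg} ∧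
    Set.BijOn (fun s : D.EnhancedState => s.vertexSet) D.Smin
      {C : Set {x : X // D.Admissible x} | D.landoGraph.IsIndepSet C} ∧
    ∀ s ∈ D.Smin, s.vertexSet.ncard = OrientedLinkDiagram.numB s.label :=
  ⟨OrientedLinkDiagram.Smin_eq_setOf_jDeg_le, D.bijOn_vertexSet⟩
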